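/- For $\kappa\in\mathbb R$ let $\operatorname{sn}_\kappa(x)=\frac{1}{\sqrt{\kappa}}\sin(\sqrt{\kappa}\,x)$ if $\kappa>0$, $\operatorname{sn}_0(x)=x$, and $\operatorname{sn}_\kappa(x)=\frac{1}{\sqrt{-\kappa}}\sinh(\sqrt{-\kappa}\,x)$ if $\kappa<0$. For a nonempty bounded subset $S$ of a metric space $(X,d)$ put $\operatorname{rad}(S)=\inf_{x\in X}\sup_{y\in S}d(x,y)$ and $\operatorname{diam}(S)=\sup_{x,y\in S}d(x,y)$. A metric space $X$ is a $\operatorname{CAT}(\kappa)$ space if any two points of $X$ (at distance $<\pi/\sqrt{\kappa}$ when $\kappa>0$) are joined by a minimal geodesic, and for every geodesic triangle in $X$ (of perimeter $<2\pi/\sqrt{\kappa}$ when $\kappa>0$) the distance between any two of its points is at most the distance between the corresponding points of a comparison triangle, i.e. a geodesic triangle with the same side lengths in the simply connected complete surface of constant curvature $\kappa$. **Theorem.** Let $\kappa\in\mathbb R$, let $X$ be a complete $\operatorname{CAT}(\kappa)$ space and let $S\subset X$ be nonempty and bounded. If $\kappa>0$, assume in addition that $\operatorname{rad}(S)<\pi/(2\sqrt{\kappa})$.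 Then there is a unique point $z\in X$ such that $S$ is contained in the closed ball $B(z,\operatorname{rad}(S))$ (so $S$ has a unique closed circumball), and $$\operatorname{sn}_\kappa(\operatorname{rad}(S))\le\sqrt2\,\operatorname{sn}_\kappa(\operatorname{diam}(S)/2).$$ -/

import Mathlib

namespace JungCAT

noncomputable section

/-- A set with a distance function; used to carry the model planes `M_κ²`. -/
structure DistSpace where
  carrier : Type
  d : carrier → carrier → ℝ

/-- The model plane `M_κ²` of constant curvature `κ`: the unit 2-sphere with its angular
metric divided by `√κ` if `κ > 0`, the Euclidean plane if `κ = 0`, and the hyperbolic plane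
(upper half-plane with its Poincaré metric of curvature `-1`) with its metric divided by
`√(-κ)` if `κ < 0`. -/
def modelPlane (κ : ℝ) : DistSpace :=
  if 0 < κ then
    ⟨Metric.sphere (0 : EuclideanSpace ℝ (Fin 3)) 1,
      fun u v => InnerProductGeometry.angle (u : EuclideanSpace ℝ (Fin 3)) v / √κ⟩
  else if κ = 0 then
    ⟨EuclideanSpace ℝ (Fin 2), fun u v => dist u v⟩
  else
    ⟨UpperHalfPlane, fun u v => dist u v / √(-κ)⟩

/-- `γ`, restricted to `[0, d x y]`, is a (minimal, unit speed) geodesic from `x` to `y` with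
respect to the distance function `d`. -/
def IsGeodesic {M : Type*} (d : M → M → ℝ) (γ : ℝ → M) (x y : M) : Prop :=
  γ 0 = x ∧ γ (d x y) = y ∧
    ∀ s ∈ Set.Icc 0 (d x y), ∀ t ∈ Set.Icc 0 (d x y), d (γ s) (γ t) = |s - t|

/-- A geodesic triangle: vertices `p 0, p 1, p 2` and sides `σ i` from `p i` to `p (i + 1)`,
the indices being taken modulo 3. -/
def IsGeodesicTriangle {M : Type*} (d : M → M → ℝ) (p : Fin 3 → M) (σ : Fin 3 → ℝ → M) : Prop :=
  ∀ i, IsGeodesic d (σ i) (p i) (p (i + 1))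

/-- The geodesic triangle with vertices `p` and sides `σ` is no thicker than its comparison
triangle in `M`: there is a geodesic triangle in `M` with the same side lengths such that the
distance of any two points of the given triangle is at most the distance of their comparison
points (the points with the same parameter on the corresponding sides).
When `M = M_κ²` and, for `κ > 0`, the perimeter is less than `2π/√κ`, the comparison triangle
exists and is unique up to isometry. -/
def TriangleComparison {X : Type*} [MetricSpace X] (M : DistSpace)
    (p : Fin 3 → X) (σ : Fin 3 → ℝ → X) : Prop :=
  ∃ (q : Fin 3 → M.carrier) (τ : Fin 3 → ℝ → M.carrier),
    IsGeodesicTriangle M.d q τ ∧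
    (∀ i, M.d (q i) (q (i + 1)) = dist (p i) (p (i + 1))) ∧
    ∀ i j : Fin 3,
      ∀ s ∈ Set.Icc 0 (dist (p i) (p (i + 1))),
      ∀ t ∈ Set.Icc 0 (dist (p j) (p (j + 1))),
        dist (σ i s) (σ j t) ≤ M.d (τ i s) (τ j t)

/-- `X` is a CAT(`κ`) space: any two points (at distance less than `π/√κ` if `κ > 0`) are joined
by a geodesic, and every geodesic triangle (of perimeter less than `2π/√κ` if `κ > 0`) is no
thicker than its comparison triangle in `M_κ²`. -/
structure IsCAT (κ : ℝ) (X : Type*) [MetricSpace X] : Prop where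
  exists_geodesic : ∀ x y : X, (0 < κ → dist x y < Real.pi / √κ) →
    ∃ γ : ℝ → X, IsGeodesic dist γ x y
  comparison : ∀ (p : Fin 3 → X) (σ : Fin 3 → ℝ → X), IsGeodesicTriangle dist p σ →
    (0 < κ → dist (p 0) (p 1) + dist (p 1) (p 2) + dist (p 2) (p 0) < 2 * (Real.pi / √κ)) →
    TriangleComparison (modelPlane κ) p σ

/-- `r_x(S) = sup {d(x, y) : y ∈ S}`. -/
def radAt {X : Type*} [MetricSpace X] (S : Set X) (x : X) : ℝ :=
  sSup {r | ∃ y ∈ S, r = dist x y}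

/-- The circumradius `rad(S) = inf {r_x(S) : x ∈ X}`. -/
def rad {X : Type*} [MetricSpace X] (S : Set X) : ℝ :=
  sInf {r | ∃ x : X, r = radAt S x}

/-- The function `sn_κ`. -/
def sn (κ x : ℝ) : ℝ :=
  if 0 < κ then 1 / √κ * Real.sin (√κ * x)
  else if κ = 0 then x
  else 1 / √(-κ) * Real.sinh (√(-κ) * x)

end

end JungCAT

/-!
# Jung's theorem in complete CAT(κ) spaces

Write `md κ` for the primitive of `sn κ` that vanishes at `0`, so that `1 - κ * md κ x` is
`cos (√κ x)`, `1` or `cosh (√(-κ) x)`. If `w` lies on a geodesic of length `l` from `u` to `v`, at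
distance `s` from `u`, then in the model plane every point `x` satisfies

`sn l * md (d w x) = sn (l - s) * (md (d u x) - md s) + sn s * (md (d v x) - md (l - s))`,

which is Stewart's theorem (`satisfiesStewart_modelPlane`); in a CAT(κ) space the left side is at
most the right side (`stewart_le`). Each half of the theorem is one application of this inequality,
combined with the fact that no point of the space has all of `S` within less than `r = rad S`.

* With `w` the midpoint of two points that are almost centers, it bounds the distance of these
  points (`md_half_dist_mul_le`). Hence approximate centers form a Cauchy sequence, and the center
  is unique.
* Let `z` be the center and let `w` be a point of a geodesic from `z` towards an almost farthest
  point `y ∈ S`. As `w` is no better than `z`, for some `x ∈ S` the comparison angle at `z`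
  between `x` and `y` is essentially at least `π / 2`. The law of cosines then says that
  `sn r ^ 2 ≤ md (diam S)`, and the right side is `2 * sn (diam S / 2) ^ 2`
  (`sn_rad_sq_le`).
-/

namespace JungCAT

open Filter Topology

/-! ### The functions `sn` and `md` -/

/-- The primitive of `sn κ` vanishing at `0`. It satisfies `1 - κ * md κ x = cos (√κ x)` for
`κ > 0` and `1 - κ * md κ x = cosh (√(-κ) x)` for `κ < 0`. -/
noncomputable def md (κ x : ℝ) : ℝ :=
  if 0 < κ then (1 - Real.cos (√κ * x)) / κ
  else if κ = 0 then x ^ 2 / 2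
  else (1 - Real.cosh (√(-κ) * x)) / κ

lemma continuous_md (κ : ℝ) : Continuous (md κ) := by
  unfold md
  split_ifs <;> fun_prop

@[simp] lemma md_zero (κ : ℝ) : md κ 0 = 0 := by
  unfold md
  split_ifs <;> simp

lemma sn_add (κ a b : ℝ) :
    sn κ (a + b) = sn κ a * (1 - κ * md κ b) + sn κ b * (1 - κ * md κ a) := by
  unfold sn md
  split_ifs with h h0
  · have : κ ≠ 0 := h.ne'
    rw [mul_add, Real.sin_add]
    field_simp
    ring
  · subst h0; ring
  · rw [mul_add, Real.sinh_add]
    field_simp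
    ring

lemma sn_sq (κ x : ℝ) : sn κ x ^ 2 = md κ x * (2 - κ * md κ x) := by
  unfold sn md
  split_ifs with h h0
  · have hk : √κ ^ 2 = κ := Real.sq_sqrt h.le
    have : κ ≠ 0 := h.ne'
    rw [mul_pow, div_pow, hk, Real.sin_sq]
    field_simp
    ring
  · subst h0; ring
  · have hk : √(-κ) ^ 2 = -κ := Real.sq_sqrt (by
      rcases lt_or_eq_of_le (not_lt.1 h) with h | h
      · linarith
      · exact absurd h h0)
    rw [mul_pow, div_pow, hk, Real.sinh_sq]
    field_simp
    ring

lemma md_two_mul (κ x : ℝ) : md κ (2 * x) = 2 * sn κ x ^ 2 := by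
  unfold sn md
  split_ifs with h h0
  · have hk : √κ ^ 2 = κ := Real.sq_sqrt h.le
    have : κ ≠ 0 := h.ne'
    rw [mul_pow, div_pow, hk, Real.sin_sq, mul_left_comm, Real.cos_two_mul]
    field_simp
    ring
  · ring
  · have hk : √(-κ) ^ 2 = -κ := Real.sq_sqrt (by
      rcases lt_or_eq_of_le (not_lt.1 h) with h | h
      · linarith
      · exact absurd h h0)
    rw [mul_pow, div_pow, hk, Real.sinh_sq, mul_left_comm, Real.cosh_two_mul, Real.sinh_sq]
    field_simp
    ring

lemma sn_pos {κ x : ℝ} (hx : 0 < x) (hκ : 0 < κ → x < Real.pi / √κ) : 0 < sn κ x := by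
  unfold sn
  split_ifs with h h0
  · have hk : 0 < √κ := Real.sqrt_pos.2 h
    have := (lt_div_iff₀ hk).1 (hκ h)
    have := Real.sin_pos_of_pos_of_lt_pi (mul_pos hk hx) (by linarith)
    positivity
  · exact hx
  · have hk : 0 < √(-κ) := Real.sqrt_pos.2 (by
      rcases lt_or_eq_of_le (not_lt.1 h) with h | h
      · linarith
      · exact absurd h h0)
    have := Real.sinh_pos_iff.2 (mul_pos hk hx)
    positivity

lemma md_lt_md {κ a b : ℝ} (ha : 0 ≤ a) (hab : a < b) (hκ : 0 < κ → b ≤ Real.pi / √κ) :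
    md κ a < md κ b := by
  unfold md
  split_ifs with h h0
  · have hk : 0 < √κ := Real.sqrt_pos.2 h
    have := (le_div_iff₀ hk).1 (hκ h)
    have := Real.cos_lt_cos_of_nonneg_of_le_pi (mul_nonneg hk.le ha)
      (by linarith : √κ * b ≤ Real.pi) (mul_lt_mul_of_pos_left hab hk)
    exact div_lt_div_of_pos_right (by linarith) h
  · nlinarith
  · have hneg : κ < 0 := lt_of_le_of_ne (not_lt.1 h) h0
    have hk : 0 < √(-κ) := Real.sqrt_pos.2 (by linarith)
    have : Real.cosh (√(-κ) * a) < Real.cosh (√(-κ) * b) := by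
      rw [Real.cosh_lt_cosh, abs_of_nonneg (by positivity),
        abs_of_nonneg (mul_nonneg hk.le (ha.trans hab.le))]
      exact mul_lt_mul_of_pos_left hab hk
    exact div_lt_div_of_neg_of_lt hneg (by linarith)

lemma md_le_md {κ a b : ℝ} (ha : 0 ≤ a) (hab : a ≤ b) (hκ : 0 < κ → b ≤ Real.pi / √κ) :
    md κ a ≤ md κ b := by
  rcases hab.eq_or_lt with rfl | h
  · exact le_rfl
  · exact (md_lt_md ha h hκ).le

lemma one_sub_mul_md_pos {κ r : ℝ} (hr : 0 ≤ r) (hκ : 0 < κ → r < Real.pi / (2 * √κ)) :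
    0 < 1 - κ * md κ r := by
  unfold md
  split_ifs with h h0
  · have hk : 0 < √κ := Real.sqrt_pos.2 h
    have h1 := (lt_div_iff₀ (by positivity)).1 (hκ h)
    rw [mul_div_cancel₀ _ h.ne', sub_sub_cancel]
    have := Real.pi_pos
    have := mul_nonneg hk.le hr
    exact Real.cos_pos_of_mem_Ioo ⟨by linarith, by linarith⟩
  · subst h0; norm_num
  · rw [mul_div_cancel₀ _ h0, sub_sub_cancel]
    exact Real.cosh_pos _

lemma two_mul_pi_div (κ : ℝ) : 2 * (Real.pi / (2 * √κ)) = Real.pi / √κ := by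
  rw [mul_comm 2 (√κ), ← div_div]
  ring

/-! ### Stewart's theorem in the model planes -/

/-- Stewart's theorem with respect to curvature `κ` in `M`, for a point `w` on a geodesic from `u`
to `v`. That `w` lies on a geodesic is expressed by its distances to `u` and `v`. -/
def SatisfiesStewart (κ : ℝ) (M : DistSpace) : Prop :=
  ∀ (u v w x : M.carrier) (l s : ℝ), M.d u v = l → M.d u w = s → M.d w v = l - s →
    sn κ l * md κ (M.d w x) =
      sn κ (l - s) * (md κ (M.d x u) - md κ s) + sn κ s * (md κ (M.d v x) - md κ (l - s))

section Euclidean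

variable {E : Type*} [NormedAddCommGroup E] [InnerProductSpace ℝ E]

open scoped InnerProductSpace

/-- On a great circle, `w` is the linear combination of `u` and `v` with the coefficients given by
spherical interpolation: the difference of the two sides has norm zero. -/
lemma sin_smul_eq_of_inner {u v w : E} {a b : ℝ} (hu : ⟪u, u⟫_ℝ = 1) (hv : ⟪v, v⟫_ℝ = 1)
    (hw : ⟪w, w⟫_ℝ = 1) (huv : ⟪u, v⟫_ℝ = Real.cos (a + b)) (huw : ⟪u, w⟫_ℝ = Real.cos a)
    (hwv : ⟪w, v⟫_ℝ = Real.cos b) :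
    Real.sin (a + b) • w = Real.sin b • u + Real.sin a • v := by
  rw [← sub_eq_zero, ← inner_self_eq_zero (𝕜 := ℝ)]
  simp only [inner_sub_left, inner_sub_right, inner_add_left, inner_add_right,
    real_inner_smul_left, real_inner_smul_right, hu, hv, hw, huv, huw, hwv,
    real_inner_comm u v, real_inner_comm u w, real_inner_comm w v]
  rw [Real.sin_add, Real.cos_add]
  have h1 := Real.sin_sq_add_cos_sq a
  have h2 := Real.sin_sq_add_cos_sq b
  have e1 : Real.cos a ^ 2 = 1 - Real.sin a ^ 2 := by linarith
  have e2 : Real.cos b ^ 2 = 1 - Real.sin b ^ 2 := by linarith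
  ring_nf
  simp only [e1, e2]
  ring

lemma smul_eq_of_dist {u v w : E} {a b : ℝ} (huv : dist u v = a + b) (huw : dist u w = a)
    (hwv : dist w v = b) : (a + b) • w = b • u + a • v := by
  have h1 : ⟪u - w, u - w⟫_ℝ = a ^ 2 := by rw [real_inner_self_eq_norm_sq, ← dist_eq_norm, huw]
  have h2 : ⟪w - v, w - v⟫_ℝ = b ^ 2 := by rw [real_inner_self_eq_norm_sq, ← dist_eq_norm, hwv]
  have h3 : ⟪(u - w) + (w - v), (u - w) + (w - v)⟫_ℝ = (a + b) ^ 2 := by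
    rw [real_inner_self_eq_norm_sq, sub_add_sub_cancel, ← dist_eq_norm, huv]
  have h4 : b • (u - w) - a • (w - v) = 0 := by
    rw [← inner_self_eq_zero (𝕜 := ℝ)]
    simp only [inner_sub_left (_ • _), inner_sub_right _ (_ • _), inner_add_left, inner_add_right,
      real_inner_smul_left, real_inner_smul_right, h1, h2, real_inner_comm (u - w) (w - v)] at h3 ⊢
    linear_combination -(a * b) * h3
  rw [← sub_eq_zero, ← neg_eq_zero, ← h4]
  module

end Euclidean

lemma satisfiesStewart_sphere {κ : ℝ} (hκ : 0 < κ) :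
    SatisfiesStewart κ ⟨Metric.sphere (0 : EuclideanSpace ℝ (Fin 3)) 1,
      fun u v => InnerProductGeometry.angle (u : EuclideanSpace ℝ (Fin 3)) v / √κ⟩ := by
  intro u v w x l s huv huw hwv
  have hk : 0 < √κ := Real.sqrt_pos.2 hκ
  have hn (p : Metric.sphere (0 : EuclideanSpace ℝ (Fin 3)) 1) :
      ‖(p : EuclideanSpace ℝ (Fin 3))‖ = 1 := by simp
  have hinner (p : Metric.sphere (0 : EuclideanSpace ℝ (Fin 3)) 1) :
      inner ℝ (p : EuclideanSpace ℝ (Fin 3)) p = 1 := by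
    rw [real_inner_self_eq_norm_sq, hn, one_pow]
  have hcos (p q : Metric.sphere (0 : EuclideanSpace ℝ (Fin 3)) 1) :
      Real.cos (√κ * (InnerProductGeometry.angle (p : EuclideanSpace ℝ (Fin 3)) q / √κ)) =
        inner ℝ (p : EuclideanSpace ℝ (Fin 3)) q := by
    rw [mul_div_cancel₀ _ hk.ne', InnerProductGeometry.cos_angle, hn, hn]
    simp
  dsimp only at huv huw hwv
  have hl : √κ * s + √κ * (l - s) = √κ * l := by ring
  have key := sin_smul_eq_of_inner (a := √κ * s) (b := √κ * (l - s)) (hinner u) (hinner v)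
    (hinner w) (by rw [← hcos, huv, hl]) (by rw [← hcos, huw]) (by rw [← hcos, hwv])
  have key' := congrArg (fun y => inner ℝ y (x : EuclideanSpace ℝ (Fin 3))) key
  simp only [inner_add_left, real_inner_smul_left, hl] at key'
  have hadd := Real.sin_add (√κ * s) (√κ * (l - s))
  rw [hl] at hadd
  simp only [sn, md, if_pos hκ, hcos]
  field_simp
  linear_combination hadd - key' + Real.sin (√κ * (l - s)) *
    real_inner_comm (u : EuclideanSpace ℝ (Fin 3)) (x : EuclideanSpace ℝ (Fin 3))

lemma satisfiesStewart_euclidean :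
    SatisfiesStewart 0 ⟨EuclideanSpace ℝ (Fin 2), fun u v => dist u v⟩ := by
  intro u v w x l s huv huw hwv
  dsimp only at huv huw hwv
  have key := smul_eq_of_dist (a := s) (b := l - s) (by rw [huv]; ring) huw hwv
  rw [add_sub_cancel] at key
  simp only [sn, md, lt_irrefl, if_false, if_true]
  have hs : 0 ≤ s := huw ▸ dist_nonneg
  have hls : 0 ≤ l - s := hwv ▸ dist_nonneg
  rcases eq_or_ne l 0 with rfl | hl
  · have : s = 0 := by linarith
    simp [this]
  have hd (p q : EuclideanSpace ℝ (Fin 2)) : dist p q ^ 2 = inner ℝ (p - q) (p - q) := by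
    rw [real_inner_self_eq_norm_sq, dist_eq_norm]
  have hw : l • (w - x) = (l - s) • (u - x) + s • (v - x) := by
    rw [smul_sub, key]
    module
  have h1 : l ^ 2 * dist w x ^ 2 = inner ℝ (l • (w - x)) (l • (w - x)) := by
    rw [hd, real_inner_smul_left, real_inner_smul_right]
    ring
  have h2 : l ^ 2 = inner ℝ ((u - x) - (v - x)) ((u - x) - (v - x)) := by
    rw [sub_sub_sub_cancel_right, ← hd, huv]
  rw [hw] at h1
  simp only [inner_add_left, inner_add_right, inner_sub_left (u - x) (v - x),
    inner_sub_right _ (u - x) (v - x),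
    real_inner_smul_left, real_inner_smul_right, real_inner_comm (u - x) (v - x), ← hd] at h1 h2
  rw [dist_comm x u]
  apply mul_left_cancel₀ hl
  linear_combination h1 / 2 + s * (l - s) / 2 * h2

/-- The half-plane embeds into the hyperboloid model by `z ↦ (1, re z, |z| ^ 2) / im z`; on its
image the hyperbolic cosine of the distance is a Lorentzian bilinear form. -/
lemma two_mul_im_mul_cosh_dist (z w : UpperHalfPlane) :
    2 * z.im * Real.cosh (dist z w) =
      (z.re ^ 2 + z.im ^ 2 + (w.re ^ 2 + w.im ^ 2) - 2 * z.re * w.re) / w.im := by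
  have := z.im_pos
  have := w.im_pos
  rw [UpperHalfPlane.cosh_dist']
  field_simp
  ring

/-- In the hyperboloid model, the difference `(α, β, γ)` of `sinh (a + b) • w` and
`sinh b • u + sinh a • v` is orthogonal to itself and to the timelike vector `w`, so it
vanishes. -/
lemma sinh_mul_cosh_dist {u v w : UpperHalfPlane} {a b : ℝ} (huv : dist u v = a + b)
    (huw : dist u w = a) (hwv : dist w v = b) (x : UpperHalfPlane) :
    Real.sinh (a + b) * Real.cosh (dist x w) =
      Real.sinh b * Real.cosh (dist x u) + Real.sinh a * Real.cosh (dist x v) := by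
  obtain ⟨α, hα⟩ : ∃ α, α = Real.sinh (a + b) / w.im - Real.sinh b / u.im - Real.sinh a / v.im :=
    ⟨_, rfl⟩
  obtain ⟨β, hβ⟩ : ∃ β, β = Real.sinh (a + b) * w.re / w.im - Real.sinh b * u.re / u.im
      - Real.sinh a * v.re / v.im := ⟨_, rfl⟩
  obtain ⟨γ, hγ⟩ : ∃ γ, γ = Real.sinh (a + b) * (w.re ^ 2 + w.im ^ 2) / w.im
      - Real.sinh b * (u.re ^ 2 + u.im ^ 2) / u.im
      - Real.sinh a * (v.re ^ 2 + v.im ^ 2) / v.im := ⟨_, rfl⟩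
  have pair (z : UpperHalfPlane) : α * (z.re ^ 2 + z.im ^ 2) + γ - 2 * β * z.re =
      2 * z.im * (Real.sinh (a + b) * Real.cosh (dist z w) - Real.sinh b * Real.cosh (dist z u)
        - Real.sinh a * Real.cosh (dist z v)) := by
    linear_combination (z.re ^ 2 + z.im ^ 2) * hα + hγ - 2 * z.re * hβ
      - Real.sinh (a + b) * two_mul_im_mul_cosh_dist z w
      + Real.sinh b * two_mul_im_mul_cosh_dist z u + Real.sinh a * two_mul_im_mul_cosh_dist z v
  have ca := Real.cosh_sq a
  have cb := Real.cosh_sq b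
  have hw : α * (w.re ^ 2 + w.im ^ 2) + γ - 2 * β * w.re = 0 := by
    rw [pair, dist_self, dist_comm w u, huw, hwv, Real.cosh_zero, Real.sinh_add]
    ring
  have hu : α * (u.re ^ 2 + u.im ^ 2) + γ - 2 * β * u.re = 0 := by
    rw [pair, dist_self, huw, huv, Real.cosh_zero, Real.sinh_add, Real.cosh_add]
    linear_combination 2 * u.im * Real.sinh b * ca
  have hv : α * (v.re ^ 2 + v.im ^ 2) + γ - 2 * β * v.re = 0 := by
    rw [pair, dist_self, dist_comm v w, hwv, dist_comm v u, huv, Real.cosh_zero, Real.sinh_add,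
      Real.cosh_add]
    linear_combination 2 * v.im * Real.sinh a * cb
  have hnull : α * γ - β ^ 2 = 0 := by
    linear_combination γ / 2 * hα + α / 2 * hγ - β * hβ + Real.sinh (a + b) / w.im / 2 * hw
      - Real.sinh b / u.im / 2 * hu - Real.sinh a / v.im / 2 * hv
  have hsum : (β - α * w.re) ^ 2 + (α * w.im) ^ 2 = 0 := by
    linear_combination α * hw - hnull
  have hα0 : α = 0 := by
    have : (α * w.im) ^ 2 = 0 := by nlinarith [sq_nonneg (β - α * w.re), sq_nonneg (α * w.im)]
    exact (mul_eq_zero.1 (pow_eq_zero_iff two_ne_zero |>.1 this)).resolve_right w.im_pos.ne'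
  have hβ0 : β = 0 := by
    rw [hα0] at hsum
    simpa using hsum
  have hγ0 : γ = 0 := by simpa [hα0, hβ0] using hw
  have hx := pair x
  rw [hα0, hβ0, hγ0] at hx
  refine mul_left_cancel₀ (mul_ne_zero two_ne_zero x.im_pos.ne') ?_
  linear_combination -hx

lemma satisfiesStewart_upperHalfPlane {κ : ℝ} (hκ : κ < 0) :
    SatisfiesStewart κ ⟨UpperHalfPlane, fun u v => dist u v / √(-κ)⟩ := by
  intro u v w x l s huv huw hwv
  have hk : 0 < √(-κ) := Real.sqrt_pos.2 (by linarith)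
  dsimp only at huv huw hwv
  rw [div_eq_iff hk.ne'] at huv huw hwv
  have hl : √(-κ) * s + √(-κ) * (l - s) = √(-κ) * l := by ring
  have key := sinh_mul_cosh_dist (a := √(-κ) * s) (b := √(-κ) * (l - s))
    (by rw [huv]; ring) (by rw [huw]; ring) (by rw [hwv]; ring) x
  have hadd := Real.sinh_add (√(-κ) * s) (√(-κ) * (l - s))
  rw [hl] at hadd key
  simp only [sn, md, if_neg hκ.not_gt, if_neg hκ.ne, mul_div_cancel₀ _ hk.ne']
  rw [dist_comm w x, dist_comm v x]
  have := hκ.ne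
  field_simp
  linear_combination hadd - key

lemma satisfiesStewart_modelPlane (κ : ℝ) : SatisfiesStewart κ (modelPlane κ) := by
  unfold modelPlane
  split_ifs with h h0
  · exact satisfiesStewart_sphere h
  · subst h0
    exact satisfiesStewart_euclidean
  · exact satisfiesStewart_upperHalfPlane (lt_of_le_of_ne (not_lt.1 h) h0)

lemma modelPlane_d_le {κ : ℝ} (hκ : 0 < κ) (u v : (modelPlane κ).carrier) :
    (modelPlane κ).d u v ≤ Real.pi / √κ := by
  have (M : DistSpace) (hM : M = modelPlane κ) (u v : M.carrier) : M.d u v ≤ Real.pi / √κ := by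
    rw [modelPlane, if_pos hκ] at hM
    subst hM
    exact div_le_div_of_nonneg_right (InnerProductGeometry.angle_le_pi _ _) (Real.sqrt_nonneg _)
  exact this _ rfl u v

/-! ### Stewart's inequality in CAT(κ) spaces -/

section CAT

variable {X : Type*} [MetricSpace X] {κ : ℝ}

/-- The first conclusion makes the monotonicity of `md κ` applicable to `dist w x`, where `w` is
the point `γ s`. -/
lemma IsCAT.stewart_le (hX : IsCAT κ X) {u v x : X} {γ : ℝ → X} (hγ : IsGeodesic dist γ u v)
    {s : ℝ} (hs : s ∈ Set.Icc 0 (dist u v)) (hvx : 0 < κ → dist v x < Real.pi / √κ)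
    (hxu : 0 < κ → dist x u < Real.pi / √κ)
    (hper : 0 < κ → dist u v + dist v x + dist x u < 2 * (Real.pi / √κ)) :
    (0 < κ → dist (γ s) x ≤ Real.pi / √κ) ∧
      (0 ≤ sn κ (dist u v) →
        sn κ (dist u v) * md κ (dist (γ s) x) ≤
          sn κ (dist u v - s) * (md κ (dist x u) - md κ s) +
            sn κ s * (md κ (dist v x) - md κ (dist u v - s))) := by
  obtain ⟨γ₁, h₁⟩ := hX.exists_geodesic v x hvx
  obtain ⟨γ₂, h₂⟩ := hX.exists_geodesic x u hxu
  obtain ⟨q, τ, hτ, hq, hle⟩ := hX.comparison ![u, v, x] ![γ, γ₁, γ₂]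
    (by intro i; fin_cases i <;> assumption) hper
  have hq0 : (modelPlane κ).d (q 0) (q 1) = dist u v := hq 0
  have hq1 : (modelPlane κ).d (q 1) (q 2) = dist v x := hq 1
  have hq2 : (modelPlane κ).d (q 2) (q 0) = dist x u := hq 2
  have hcmp : dist (γ s) x ≤ (modelPlane κ).d (τ 0 s) (q 2) := by
    have h := hle 0 1 s hs (dist v x) ⟨dist_nonneg, le_rfl⟩
    have e1 : (![γ, γ₁, γ₂] : Fin 3 → ℝ → X) 1 (dist v x) = x := h₁.2.1
    have e2 : τ 1 (dist v x) = q 2 := by rw [← hq1]; exact (hτ 1).2.1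
    rwa [e1, e2] at h
  obtain ⟨t0, t1, t2⟩ : IsGeodesic (modelPlane κ).d (τ 0) (q 0) (q 1) := hτ 0
  rw [hq0] at t1 t2
  have h0 : (0 : ℝ) ∈ Set.Icc 0 (dist u v) := ⟨le_rfl, dist_nonneg⟩
  have hl : dist u v ∈ Set.Icc 0 (dist u v) := ⟨dist_nonneg, le_rfl⟩
  have d1 : (modelPlane κ).d (q 0) (τ 0 s) = s := by
    have h := t2 0 h0 s hs
    rwa [t0, zero_sub, abs_neg, abs_of_nonneg hs.1] at h
  have d2 : (modelPlane κ).d (τ 0 s) (q 1) = dist u v - s := by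
    have h := t2 s hs _ hl
    rwa [t1, abs_sub_comm, abs_of_nonneg (sub_nonneg.2 hs.2)] at h
  refine ⟨fun h => hcmp.trans (modelPlane_d_le h _ _), fun hsn => ?_⟩
  have key := satisfiesStewart_modelPlane κ (q 0) (q 1) (τ 0 s) (q 2) _ _ hq0 d1 d2
  rw [hq1, hq2] at key
  rw [← key]
  exact mul_le_mul_of_nonneg_left
    (md_le_md dist_nonneg hcmp fun h => modelPlane_d_le h _ _) hsn

/-! ### The circumradius -/

variable {S : Set X}

lemma bddAbove_dist (hbdd : Bornology.IsBounded S) (x : X) :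
    BddAbove {r | ∃ y ∈ S, r = dist x y} := by
  obtain ⟨C, hC⟩ := hbdd.subset_closedBall x
  refine ⟨C, ?_⟩
  rintro _ ⟨y, hy, rfl⟩
  rw [dist_comm]
  exact hC hy

lemma radAt_nonneg (S : Set X) (x : X) : 0 ≤ radAt S x :=
  Real.sSup_nonneg (by rintro _ ⟨y, -, rfl⟩; exact dist_nonneg)

lemma rad_nonneg (S : Set X) : 0 ≤ rad S :=
  Real.sInf_nonneg (by rintro _ ⟨x, rfl⟩; exact radAt_nonneg S x)

lemma exists_dist_le_of_rad_lt (hne : S.Nonempty) (hbdd : Bornology.IsBounded S) {ρ : ℝ}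
    (hρ : rad S < ρ) : ∃ x : X, ∀ y ∈ S, dist x y ≤ ρ := by
  obtain ⟨_, ⟨x, rfl⟩, hx⟩ := exists_lt_of_csInf_lt
    (s := {r | ∃ x : X, r = radAt S x}) ⟨_, hne.some, rfl⟩ hρ
  exact ⟨x, fun y hy => (le_csSup (bddAbove_dist hbdd x) ⟨y, hy, rfl⟩).trans hx.le⟩

lemma exists_lt_dist_of_lt_rad (hne : S.Nonempty) {a : ℝ} (ha : a < rad S) (x : X) :
    ∃ y ∈ S, a < dist x y := by
  have h : rad S ≤ radAt S x :=
    csInf_le ⟨0, by rintro _ ⟨x, rfl⟩; exact radAt_nonneg S x⟩ ⟨x, rfl⟩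
  obtain ⟨_, ⟨y, hy, rfl⟩, hlt⟩ := exists_lt_of_lt_csSup
    (s := {r | ∃ y ∈ S, r = dist x y}) ⟨_, hne.some, hne.some_mem, rfl⟩ (ha.trans_le h)
  exact ⟨y, hy, hlt⟩

lemma rad_le_of_forall_dist_le (hne : S.Nonempty) {ρ : ℝ} {x : X} (h : ∀ y ∈ S, dist x y ≤ ρ) :
    rad S ≤ ρ := by
  by_contra! hlt
  obtain ⟨y, hy, hxy⟩ := exists_lt_dist_of_lt_rad hne hlt x
  exact absurd (h y hy) hxy.not_ge

/-- No point `w` has all of `S` within less than `rad S`, expressed through `md κ`. -/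
lemma md_rad_le (hne : S.Nonempty) {w : X} {M : ℝ} (hw : ∀ y ∈ S, 0 < κ → dist w y ≤ Real.pi / √κ)
    (hM : ∀ y ∈ S, md κ (dist w y) ≤ M) : md κ (rad S) ≤ M := by
  rcases (rad_nonneg S).eq_or_lt with h0 | h0
  · obtain ⟨y, hy⟩ := hne
    rw [← h0]
    exact (md_le_md le_rfl dist_nonneg (hw y hy)).trans (hM y hy)
  have hev : ∀ᶠ a in 𝓝[<] rad S, md κ a ≤ M := by
    filter_upwards [Ioo_mem_nhdsLT h0] with a ha
    obtain ⟨y, hy, hay⟩ := exists_lt_dist_of_lt_rad hne ha.2 w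
    exact (md_le_md ha.1.le hay.le (hw y hy)).trans (hM y hy)
  exact le_of_tendsto ((continuous_md κ).continuousAt.tendsto.mono_left nhdsWithin_le_nhds) hev

/-! ### Existence and uniqueness of the circumcenter -/

/-- Two points whose balls of radius `ρ` contain `S` are close to each other if `ρ` is close to
`rad S`, since otherwise their midpoint would be a better center than `rad S` permits. -/
lemma IsCAT.md_half_dist_mul_le (hX : IsCAT κ X) (hne : S.Nonempty) {ρ : ℝ}
    (hρ : 0 < κ → ρ < Real.pi / (2 * √κ)) {a b : X} (ha : ∀ y ∈ S, dist a y ≤ ρ)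
    (hb : ∀ y ∈ S, dist b y ≤ ρ) :
    md κ (dist a b / 2) * (1 - κ * md κ (rad S)) ≤ md κ ρ - md κ (rad S) := by
  have hpi := two_mul_pi_div κ
  have hρ0 : rad S ≤ ρ := rad_le_of_forall_dist_le hne ha
  have hρ' : 0 < κ → ρ ≤ Real.pi / √κ := fun h => by
    have := hρ h
    have := rad_nonneg S
    linarith
  have hab : dist a b ≤ 2 * ρ := by
    obtain ⟨y, hy⟩ := hne
    have := dist_triangle_right a b y
    have := ha y hy
    have := hb y hy
    linarith
  rcases (dist_nonneg (x := a) (y := b)).eq_or_lt with h0 | h0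
  · rw [← h0]
    have := md_le_md (rad_nonneg S) hρ0 hρ'
    simpa using this
  have hab' : 0 < κ → dist a b < Real.pi / √κ := fun h => by linarith [hρ h]
  obtain ⟨γ, hγ⟩ := hX.exists_geodesic a b hab'
  obtain ⟨c, hc⟩ : ∃ c, c = dist a b / 2 := ⟨_, rfl⟩
  have hc0 : 0 < c := by linarith
  have hcs : dist a b - c = c := by linarith
  have hcc : dist a b = c + c := by linarith
  have st (y : X) (hy : y ∈ S) := hX.stewart_le (x := y) (s := c) hγ ⟨hc0.le, by linarith⟩
    (fun h => by linarith [hρ h, hb y hy, rad_nonneg S])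
    (fun h => by linarith [hρ h, ha y hy, dist_comm a y, rad_nonneg S])
    (fun h => by linarith [hρ h, ha y hy, dist_comm a y, hb y hy])
  have hsnc : 0 < sn κ c := sn_pos hc0 fun h => by linarith [hab' h]
  have hsn : 0 < sn κ (dist a b) := sn_pos h0 hab'
  have hle : md κ (rad S) ≤ 2 * sn κ c * (md κ ρ - md κ c) / sn κ (dist a b) := by
    refine md_rad_le hne (fun y hy => (st y hy).1) fun y hy => ?_
    rw [le_div_iff₀' hsn]
    have h := (st y hy).2 hsn.le
    rw [hcs] at h
    have h1 : md κ (dist y a) ≤ md κ ρ :=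
      md_le_md dist_nonneg (by rw [dist_comm]; exact ha y hy) hρ'
    have h2 : md κ (dist b y) ≤ md κ ρ := md_le_md dist_nonneg (hb y hy) hρ'
    nlinarith [mul_le_mul_of_nonneg_left h1 hsnc.le, mul_le_mul_of_nonneg_left h2 hsnc.le]
  rw [le_div_iff₀' hsn, hcc, sn_add] at hle
  rw [← hc]
  refine le_of_mul_le_mul_left ?_ (mul_pos two_pos hsnc)
  linarith

lemma IsCAT.eventually_dist_le (hX : IsCAT κ X) (hne : S.Nonempty)
    (hrad : 0 < κ → rad S < Real.pi / (2 * √κ)) {ε : ℝ} (hε : 0 < ε) :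
    ∀ᶠ ρ in 𝓝 (rad S), ∀ a b : X, (∀ y ∈ S, dist a y ≤ ρ) → (∀ y ∈ S, dist b y ≤ ρ) →
      dist a b ≤ ε := by
  have hrange : ∀ᶠ ρ in 𝓝 (rad S), 0 < κ → ρ < Real.pi / (2 * √κ) := by
    by_cases h : 0 < κ
    · filter_upwards [eventually_lt_nhds (hrad h)] with ρ hρ _ using hρ
    · exact Eventually.of_forall fun _ h' => absurd h' h
  have hpi := two_mul_pi_div κ
  have hdist : ∀ ρ, (0 < κ → ρ < Real.pi / (2 * √κ)) → ∀ a b : X, (∀ y ∈ S, dist a y ≤ ρ) →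
      (∀ y ∈ S, dist b y ≤ ρ) → 0 < κ → dist a b ≤ Real.pi / √κ := by
    intro ρ hρ a b ha hb h
    obtain ⟨y, hy⟩ := hne
    linarith [dist_triangle_right a b y, ha y hy, hb y hy, hρ h]
  by_cases hκε : 0 < κ → ε ≤ Real.pi / √κ
  · have hpos : 0 < md κ (ε / 2) * (1 - κ * md κ (rad S)) := by
      refine mul_pos ?_ (one_sub_mul_md_pos (rad_nonneg S) hrad)
      rw [← md_zero κ]
      exact md_lt_md le_rfl (by linarith) fun h => by linarith [hκε h]
    have hcont : ∀ᶠ ρ in 𝓝 (rad S),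
        md κ ρ - md κ (rad S) < md κ (ε / 2) * (1 - κ * md κ (rad S)) := by
      have : Tendsto (fun ρ => md κ ρ - md κ (rad S)) (𝓝 (rad S)) (𝓝 0) := by
        rw [← sub_self (md κ (rad S))]
        exact ((continuous_md κ).tendsto _).sub_const _
      exact this.eventually_lt_const hpos
    filter_upwards [hrange, hcont] with ρ hρ hlt a b ha hb
    by_contra! hab
    have h1 := hX.md_half_dist_mul_le hne hρ ha hb
    have h2 : md κ (ε / 2) < md κ (dist a b / 2) := md_lt_md (by linarith) (by linarith)
      fun h => by linarith [hdist ρ hρ a b ha hb h, dist_nonneg (x := a) (y := b)]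
    nlinarith [mul_lt_mul_of_pos_right h2 (one_sub_mul_md_pos (rad_nonneg S) hrad)]
  -- Here `md κ (ε / 2)` carries no information, but `ε` exceeds `π / √κ`.
  · push Not at hκε
    filter_upwards [hrange] with ρ hρ a b ha hb
    exact (hdist ρ hρ a b ha hb hκε.1).trans hκε.2.le

lemma IsCAT.existsUnique_dist_le_rad [CompleteSpace X] (hX : IsCAT κ X) (hne : S.Nonempty)
    (hbdd : Bornology.IsBounded S) (hrad : 0 < κ → rad S < Real.pi / (2 * √κ)) :
    ∃! z : X, ∀ y ∈ S, dist z y ≤ rad S := by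
  obtain ⟨ρ, hanti, hlt, hlim⟩ := exists_seq_strictAnti_tendsto (rad S)
  choose c hc using fun n => exists_dist_le_of_rad_lt hne hbdd (hlt n)
  have hcauchy : CauchySeq c := by
    refine Metric.cauchySeq_iff'.2 fun ε hε => ?_
    obtain ⟨N, hN⟩ :=
      (hlim.eventually (hX.eventually_dist_le hne hrad (half_pos hε))).exists
    refine ⟨N, fun n hn => ?_⟩
    refine (hN _ _ (fun y hy => (hc n y hy).trans (hanti.antitone hn)) (hc N)).trans_lt ?_
    linarith
  obtain ⟨z, hz⟩ := cauchySeq_tendsto_of_complete hcauchy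
  refine ⟨z, fun y hy => ?_, fun z' hz' => ?_⟩
  · exact le_of_tendsto_of_tendsto' (hz.dist tendsto_const_nhds) hlim fun n => hc n y hy
  · refine dist_le_zero.1 (le_of_forall_gt_imp_ge_of_dense fun ε hε => ?_)
    refine (hX.eventually_dist_le hne hrad hε).self_of_nhds z' z hz' fun y hy => ?_
    exact le_of_tendsto_of_tendsto' (hz.dist tendsto_const_nhds) hlim fun n => hc n y hy

/-! ### Jung's inequality -/

/-- The left side is `md κ` of the hypotenuse of a right triangle in the model plane with both legs
equal to `rad S`. -/
lemma IsCAT.sn_rad_sq_le (hX : IsCAT κ X) (hne : S.Nonempty) (hbdd : Bornology.IsBounded S)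
    (hrad : 0 < κ → rad S < Real.pi / (2 * √κ)) {z : X} (hz : ∀ y ∈ S, dist z y ≤ rad S) :
    sn κ (rad S) ^ 2 ≤ md κ (Metric.diam S) := by
  have hpi := two_mul_pi_div κ
  have hdiam : Metric.diam S ≤ 2 * rad S :=
    Metric.diam_le_of_subset_closedBall (rad_nonneg S) fun y hy => by
      rw [Metric.mem_closedBall, dist_comm]
      exact hz y hy
  have hdiam' : 0 < κ → Metric.diam S < Real.pi / √κ := fun h => by linarith [hrad h]
  have hrad' : 0 < κ → rad S < Real.pi / √κ := fun h => by linarith [hrad h, rad_nonneg S]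
  rcases (rad_nonneg S).eq_or_lt with h0 | h0
  · rw [sn_sq, ← h0, md_zero, zero_mul, ← md_zero κ]
    exact md_le_md le_rfl Metric.diam_nonneg fun h => (hdiam' h).le
  have hr1 := one_sub_mul_md_pos (rad_nonneg S) hrad
  have main : ∀ a, 0 < a → a < rad S →
      (1 - κ * md κ a) * md κ (rad S) + md κ a ≤ md κ (Metric.diam S) := by
    intro a ha har
    obtain ⟨y, hy, hay⟩ := exists_lt_dist_of_lt_rad hne har z
    have hl := hz y hy
    obtain ⟨l, hl'⟩ : ∃ l, l = dist z y := ⟨_, rfl⟩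
    have hlκ : 0 < κ → l < Real.pi / √κ := fun h => by linarith [hrad' h]
    obtain ⟨γ, hγ⟩ := hX.exists_geodesic z y (hl' ▸ hlκ)
    -- `γ s` is the point at distance `a` from `y`; it is no better a center than `z`.
    obtain ⟨s, hs⟩ : ∃ s, s = l - a := ⟨_, rfl⟩
    have hs0 : 0 < s := by linarith
    have hyx (x : X) (hx : x ∈ S) : dist y x ≤ Metric.diam S :=
      Metric.dist_le_diam_of_mem hbdd hy hx
    have st (x : X) (hx : x ∈ S) := hX.stewart_le (x := x) (s := s) hγ ⟨hs0.le, by linarith⟩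
      (fun h => by linarith [hdiam' h, hyx x hx])
      (fun h => by linarith [hrad' h, hz x hx, dist_comm z x])
      (fun h => by linarith [hrad h, hyx x hx, hz x hx, dist_comm z x])
    simp only [← hl', show l - s = a by linarith] at st
    have hsna : 0 < sn κ a := sn_pos ha fun h => by linarith [hrad' h]
    have hsns : 0 < sn κ s := sn_pos hs0 fun h => by linarith [hlκ h]
    have hsnl : 0 < sn κ l := sn_pos (by linarith) hlκ
    have hle : md κ (rad S) ≤ (sn κ a * (md κ (rad S) - md κ s) +
        sn κ s * (md κ (Metric.diam S) - md κ a)) / sn κ l := by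
      refine md_rad_le hne (fun x hx => (st x hx).1) fun x hx => ?_
      rw [le_div_iff₀' hsnl]
      refine ((st x hx).2 hsnl.le).trans ?_
      have h1 : md κ (dist x z) ≤ md κ (rad S) :=
        md_le_md dist_nonneg (by rw [dist_comm]; exact hz x hx) fun h => (hrad' h).le
      have h2 : md κ (dist y x) ≤ md κ (Metric.diam S) :=
        md_le_md dist_nonneg (hyx x hx) fun h => (hdiam' h).le
      gcongr
    rw [le_div_iff₀' hsnl, show l = a + s by linarith, sn_add] at hle
    have hmds : 0 ≤ md κ s := by
      rw [← md_zero κ]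
      exact md_le_md le_rfl hs0.le fun h => by linarith [hlκ h]
    have := mul_nonneg (mul_nonneg hsna.le hmds) hr1.le
    refine le_of_mul_le_mul_left ?_ hsns
    linarith
  have hlim : Tendsto (fun a => (1 - κ * md κ a) * md κ (rad S) + md κ a) (𝓝[<] rad S)
      (𝓝 ((1 - κ * md κ (rad S)) * md κ (rad S) + md κ (rad S))) := by
    have := continuous_md κ
    exact (Continuous.tendsto (by fun_prop) _).mono_left nhdsWithin_le_nhds
  have := le_of_tendsto hlim (by
    filter_upwards [Ioo_mem_nhdsLT h0] with a ha using main a ha.1 ha.2)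
  rw [sn_sq]
  linarith

end CAT

end JungCAT

theorem theorem2p2 {X : Type*} [MetricSpace X] [CompleteSpace X] (κ : ℝ)
    (hX : JungCAT.IsCAT κ X) (S : Set X) (hne : S.Nonempty) (hbdd : Bornology.IsBounded S)
    (hrad : 0 < κ → JungCAT.rad S < Real.pi / (2 * √κ)) :
    (∃! z : X, S ⊆ Metric.closedBall z (JungCAT.rad S)) ∧
      JungCAT.sn κ (JungCAT.rad S) ≤ √2 * JungCAT.sn κ (Metric.diam S / 2) := by
  have hex := hX.existsUnique_dist_le_rad hne hbdd hrad
  have hsub (z : X) : S ⊆ Metric.closedBall z (JungCAT.rad S) ↔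
      ∀ y ∈ S, dist z y ≤ JungCAT.rad S := by
    simp only [Set.subset_def, Metric.mem_closedBall, dist_comm]
  refine ⟨by simpa only [hsub] using hex, ?_⟩
  obtain ⟨z, hz, -⟩ := hex
  have hdiam : Metric.diam S ≤ 2 * JungCAT.rad S :=
    Metric.diam_le_of_subset_closedBall (JungCAT.rad_nonneg S) ((hsub z).2 hz)
  have hsn : 0 ≤ JungCAT.sn κ (Metric.diam S / 2) := by
    rcases (Metric.diam_nonneg (s := S)).eq_or_lt with h | h
    · simp [← h, JungCAT.sn]
    · refine (JungCAT.sn_pos (by linarith) fun hκ => ?_).le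
      linarith [hrad hκ, JungCAT.two_mul_pi_div κ]
  have key := hX.sn_rad_sq_le hne hbdd hrad hz
  rw [← mul_div_cancel₀ (Metric.diam S) (two_ne_zero (α := ℝ)), JungCAT.md_two_mul] at key
  refine le_of_sq_le_sq ?_ (by positivity)
  rwa [mul_pow, Real.sq_sqrt zero_le_two]
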